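/- Let $R$ be a commutative Noetherian ring (with identity; all modules are unitary). Call an $R$-module $M$ *simple-direct-injective* if, whenever $A$ and $B$ are simple submodules of $M$ with $A \cong B$ and $B$ a direct summand of $M$, then $A$ is a direct summand of $M$. Call $M$ *simple-direct-projective* if, whenever $A$ and $B$ are submodules of $M$ with $B$ simple, $M/A \cong B$ and $B$ a direct summand of $M$, then $A$ is a direct summand of $M$. Then the following statements are equivalent. 1. $R$ is Artinian. 2. Every simple-direct-injective $R$-module is simple-direct-projective. 3. Every simple-direct-projective $R$-module is simple-direct-injective. -/

import Mathlib

universe u v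

/-- `M` is simple-direct-injective: whenever `A` and `B` are simple submodules of `M` with `A ≅ B`
and `B` a direct summand of `M`, then `A` is a direct summand of `M`. -/
def IsSimpleDirectInjective (R : Type u) (M : Type v) [Ring R] [AddCommGroup M] [Module R M] :
    Prop :=
  ∀ A B : Submodule R M, IsSimpleModule R A → IsSimpleModule R B → Nonempty (A ≃ₗ[R] B) →
    IsComplemented B → IsComplemented A

/-- `M` is simple-direct-projective: whenever `A` and `B` are submodules of `M` with `B` simple,
`M / A ≅ B` and `B` a direct summand of `M`, then `A` is a direct summand of `M`. -/
def IsSimpleDirectProjective (R : Type u) (M : Type v) [Ring R] [AddCommGroup M] [Module R M] :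
    Prop :=
  ∀ A B : Submodule R M, IsSimpleModule R B → Nonempty ((M ⧸ A) ≃ₗ[R] B) →
    IsComplemented B → IsComplemented A

/-!
Let `m` be a maximal ideal of `R`.

*Artinian rings.* The powers of `m` stabilise, so `m ^ n = (f)` with `f` idempotent for some
`n ≠ 0`. Suppose `M` has a simple direct summand isomorphic to `R ⧸ m`.

If `M` is simple-direct-injective, every copy of `R ⧸ m` in `M` is a direct summand, hence meets
`m M` trivially: a nonzero element of `m M` is never killed by `m`. Thus a submodule killed by a
power of `m` is killed by `m`. For `A ≤ M` with `M ⧸ A ≃ R ⧸ m` and `y ∉ A`, this applies to the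
span of `(1 - f) y`, which is killed by `m ^ n`; since `f y ∈ A`, that span is a complement of `A`.

If `M` is simple-direct-projective, every kernel of a map `M → R ⧸ m` is a direct summand.
Then `M = T + m M`, with `T` the set of elements killed by `m`, since otherwise some nonzero
`M → R ⧸ m` kills `T + m M`, and a complement of its kernel, being killed by `m`, lies in `T`.
Iterating, `m M = m ^ n M = f M`, so `m M` meets `T` trivially. A simple `A ≃ R ⧸ m` lies in `T`, so
it is not in `m M`, and some map `M → R ⧸ m` is injective on `A`; its kernel is a complement.

*Non-Artinian Noetherian rings.* There is a prime `p` that is strictly contained in a maximal ideal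
`m`. The module `R ⧸ p` has no simple submodule but maps onto `R ⧸ m`, so `(R ⧸ m) × (R ⧸ p)` is
simple-direct-injective and not simple-direct-projective. The module `κ(p) ⧸ m (R ⧸ p)`, with `κ(p)`
the fraction field of `R ⧸ p`, has no simple quotient but contains a copy of `R ⧸ m`, generated by
the class of `1`, so its product with `R ⧸ m` is simple-direct-projective and not
simple-direct-injective.
-/

/-! ### Copies of `R ⧸ I` inside and above a module -/

section ResidueModules

variable {R : Type*} [CommRing R] {M : Type*} [AddCommGroup M] [Module R M] {I : Ideal R}

lemma nonempty_quotient_equiv_span_singleton (hI : I.IsMaximal) {z : M} (hz : z ≠ 0)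
    (h : ∀ a ∈ I, a • z = 0) : Nonempty ((R ⧸ I) ≃ₗ[R] Submodule.span R {z}) := by
  have hker : LinearMap.ker (LinearMap.toSpanSingleton R M z) = I := by
    refine (hI.eq_of_le ?_ fun a ha ↦ by simpa using h a ha).symm
    intro htop
    have : (1 : R) ∈ LinearMap.ker (LinearMap.toSpanSingleton R M z) := htop ▸ Submodule.mem_top
    exact hz (by simpa using this)
  exact ⟨(Submodule.quotEquivOfEq _ _ hker.symm).trans <|
    (LinearMap.quotKerEquivRange _).trans <|
      LinearEquiv.ofEq _ _ (LinearMap.span_singleton_eq_range R M z).symm⟩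

lemma smul_quotient_eq_zero {a : R} (ha : a ∈ I) (x : R ⧸ I) : a • x = 0 := by
  obtain ⟨r, rfl⟩ := Ideal.Quotient.mk_surjective x
  rw [Algebra.smul_def, Ideal.Quotient.algebraMap_eq, Ideal.Quotient.eq_zero_iff_mem.mpr ha,
    zero_mul]

/-- An element outside a submodule containing `I M` is detected by a map to the field `R ⧸ I`
vanishing on that submodule. -/
lemma exists_linearMap_quotient_ne_zero (hI : I.IsMaximal) {P : Submodule R M}
    (hP : I • (⊤ : Submodule R M) ≤ P) {x : M} (hx : x ∉ P) :
    ∃ g : M →ₗ[R] R ⧸ I, P ≤ LinearMap.ker g ∧ g x ≠ 0 := by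
  let _ := Ideal.Quotient.field I
  have htors : Module.IsTorsionBySet R (M ⧸ P) I := by
    rintro y ⟨a, ha⟩
    obtain ⟨y, rfl⟩ := Submodule.Quotient.mk_surjective P y
    change a • Submodule.Quotient.mk y = 0
    rw [← Submodule.Quotient.mk_smul, Submodule.Quotient.mk_eq_zero]
    exact hP (Submodule.smul_mem_smul ha Submodule.mem_top)
  let _ := htors.module
  have : IsScalarTower R (R ⧸ I) (M ⧸ P) := htors.isScalarTower
  have hx' : P.mkQ x ≠ 0 := by simpa using hx
  obtain ⟨g, hg⟩ : ∃ g : Module.Dual (R ⧸ I) (M ⧸ P), g (P.mkQ x) ≠ 0 := by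
    by_contra! hall
    exact hx' ((Module.forall_dual_apply_eq_zero_iff (R ⧸ I) _).mp hall)
  refine ⟨(g.restrictScalars R).comp P.mkQ, fun y hy ↦ ?_, hg⟩
  have : P.mkQ y = 0 := by simpa using hy
  rw [LinearMap.mem_ker, LinearMap.comp_apply, this, map_zero]

lemma isCompl_of_isAtom_of_isCoatom {A N : Submodule R M} (hA : IsAtom A) (hN : IsCoatom N)
    (h : ¬ A ≤ N) : IsCompl A N :=
  ⟨hA.not_le_iff_disjoint.mp h, codisjoint_iff.mpr (hN.2 _ (right_lt_sup.mpr h))⟩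

end ResidueModules

/-! ### Artinian rings -/

section Artinian

variable {R : Type*} [CommRing R] {M : Type*} [AddCommGroup M] [Module R M] {I : Ideal R}

lemma exists_pow_eq_span_isIdempotentElem [IsArtinianRing R] (I : Ideal R) :
    ∃ n ≠ 0, ∃ f : R, f * f = f ∧ I ^ n = Ideal.span {f} := by
  obtain ⟨n, hn⟩ := IsArtinian.monotone_stabilizes (R := R) (M := R)
    ⟨fun k ↦ OrderDual.toDual (I ^ k), fun _ _ h ↦ Ideal.pow_le_pow_right h⟩
  have hn' : ∀ k, n ≤ k → I ^ n = I ^ k := fun k hk ↦ OrderDual.toDual.injective (hn k hk)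
  have hidem : IsIdempotentElem (I ^ (n + 1)) := by
    rw [IsIdempotentElem, ← pow_add, ← hn' (n + 1) (by lia), ← hn' _ (by lia)]
  obtain ⟨f, hf, h⟩ := (Ideal.isIdempotentElem_iff_of_fg _
    (IsNoetherian.noetherian (I ^ (n + 1)))).mp hidem
  exact ⟨n + 1, n.succ_ne_zero, f, hf, h⟩

/-- In a simple-direct-injective module with a direct summand isomorphic to `R ⧸ I`, the copies of
`R ⧸ I` are direct summands, so none lies in `I M`. -/
lemma IsSimpleDirectInjective.eq_zero_of_mem_smul_top (hM : IsSimpleDirectInjective R M)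
    (hI : I.IsMaximal) {B : Submodule R M} (hB : IsSimpleModule R B) (e : B ≃ₗ[R] R ⧸ I)
    (hBc : IsComplemented B) {z : M} (hz : z ∈ I • (⊤ : Submodule R M))
    (h : ∀ a ∈ I, a • z = 0) : z = 0 := by
  by_contra hz0
  obtain ⟨e'⟩ := nonempty_quotient_equiv_span_singleton hI hz0 h
  obtain ⟨C, hC⟩ := hM (Submodule.span R {z}) B
    ((e.trans e').isSimpleModule_iff.mp hB) hB ⟨(e.trans e').symm⟩ hBc
  have hle : I • (⊤ : Submodule R M) ≤ C := by
    rw [← hC.sup_eq_top, Submodule.smul_sup]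
    refine sup_le (Submodule.smul_le.mpr fun a ha y hy ↦ ?_) Submodule.smul_le_right
    obtain ⟨r, rfl⟩ := Submodule.mem_span_singleton.mp hy
    rw [smul_comm, h a ha, smul_zero]
    exact C.zero_mem
  exact hz0 (Submodule.disjoint_def.mp hC.disjoint z (Submodule.mem_span_singleton_self z) (hle hz))

lemma smul_eq_bot_of_pow_smul_eq_bot
    (H : ∀ z ∈ I • (⊤ : Submodule R M), (∀ a ∈ I, a • z = 0) → z = 0) (V : Submodule R M) (n : ℕ)
    (h : I ^ (n + 1) • V = ⊥) : I • V = ⊥ := by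
  induction n with
  | zero => simpa using h
  | succ n ih =>
    refine ih ((Submodule.eq_bot_iff _).mpr fun z hz ↦ H z ?_ fun a ha ↦ ?_)
    · exact Submodule.smul_mono (Ideal.pow_le_self n.succ_ne_zero) le_top hz
    · have := Submodule.smul_mem_smul ha hz
      rwa [← Submodule.mul_smul, ← pow_succ', h, Submodule.mem_bot] at this

theorem IsSimpleDirectInjective.isSimpleDirectProjective [IsArtinianRing R]
    (hM : IsSimpleDirectInjective R M) : IsSimpleDirectProjective R M := by
  rintro A B hB ⟨eA⟩ hBc
  obtain ⟨I, hI, ⟨e⟩⟩ := isSimpleModule_iff_quot_maximal.mp hB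
  obtain ⟨n, hn, f, hff, hf⟩ := exists_pow_eq_span_isIdempotentElem I
  have hfI : f ∈ I := Ideal.pow_le_self hn (hf ▸ Ideal.mem_span_singleton_self f)
  have hA : IsCoatom A := isSimpleModule_iff_isCoatom.mp (eA.isSimpleModule_iff.mpr hB)
  obtain ⟨y, hy⟩ : ∃ y, y ∉ A := by
    by_contra! hall
    exact hA.1 (eq_top_iff.mpr fun y _ ↦ hall y)
  have hfy : f • y ∈ A := by
    rw [← Submodule.Quotient.mk_eq_zero, ← (eA.trans e).map_eq_zero_iff,
      Submodule.Quotient.mk_smul, map_smul, smul_quotient_eq_zero hfI]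
  have hz : (1 - f) • y ∉ A := fun h ↦ hy (by simpa [sub_smul] using A.add_mem h hfy)
  have hzero : I • Submodule.span R {(1 - f) • y} = ⊥ := by
    obtain ⟨n, rfl⟩ := Nat.exists_eq_succ_of_ne_zero hn
    refine smul_eq_bot_of_pow_smul_eq_bot
      (fun z hz h ↦ hM.eq_zero_of_mem_smul_top hI hB e hBc hz h) _ n ?_
    rw [← Nat.succ_eq_add_one, hf, Ideal.span, Submodule.span_smul_span]
    simp [smul_smul, mul_sub, hff]
  obtain ⟨e'⟩ := nonempty_quotient_equiv_span_singleton hI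
    (z := (1 - f) • y) (fun h ↦ hz (by rw [h]; exact A.zero_mem)) fun a ha ↦
      (Submodule.mem_bot R).mp <| hzero ▸
        Submodule.smul_mem_smul ha (Submodule.mem_span_singleton_self ((1 - f) • y))
  have hatom := isSimpleModule_iff_isAtom.mp ((e.trans e').isSimpleModule_iff.mp hB)
  exact ⟨_, (isCompl_of_isAtom_of_isCoatom hatom hA fun h ↦
    hz (h (Submodule.mem_span_singleton_self _))).symm⟩

lemma IsSimpleDirectProjective.isComplemented_ker (hM : IsSimpleDirectProjective R M)
    {B : Submodule R M} (hB : IsSimpleModule R B) (e : B ≃ₗ[R] R ⧸ I)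
    (hBc : IsComplemented B) {g : M →ₗ[R] R ⧸ I} (hg : g ≠ 0) :
    IsComplemented (LinearMap.ker g) := by
  have : IsSimpleModule R (R ⧸ I) := e.isSimpleModule_iff.mp hB
  exact hM _ B hB
    ⟨(g.quotKerEquivOfSurjective (LinearMap.surjective_of_ne_zero hg)).trans e.symm⟩ hBc

/-- A simple-direct-projective module with a direct summand isomorphic to `R ⧸ I` is generated, up
to `I M`, by its elements killed by `I`. -/
lemma IsSimpleDirectProjective.torsionBySet_sup_smul_top (hM : IsSimpleDirectProjective R M)
    (hI : I.IsMaximal) {B : Submodule R M} (hB : IsSimpleModule R B) (e : B ≃ₗ[R] R ⧸ I)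
    (hBc : IsComplemented B) :
    Submodule.torsionBySet R M I ⊔ I • (⊤ : Submodule R M) = ⊤ := by
  by_contra hne
  obtain ⟨y, hy⟩ : ∃ y, y ∉ Submodule.torsionBySet R M I ⊔ I • (⊤ : Submodule R M) := by
    by_contra! hall
    exact hne (eq_top_iff.mpr fun y _ ↦ hall y)
  obtain ⟨g, hg, hgy⟩ := exists_linearMap_quotient_ne_zero hI le_sup_right hy
  obtain ⟨C, hC⟩ := hM.isComplemented_ker hB e hBc (g := g) fun h ↦ hgy (by simp [h])
  have hCT : C ≤ Submodule.torsionBySet R M I := by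
    intro c hc
    rw [Submodule.mem_torsionBySet_iff]
    rintro ⟨a, ha⟩
    refine Submodule.disjoint_def.mp hC.disjoint _ ?_ (C.smul_mem a hc)
    rw [LinearMap.mem_ker, map_smul, smul_quotient_eq_zero ha]
  have hker : LinearMap.ker g = ⊤ := by
    rw [← hC.sup_eq_top, left_eq_sup]
    exact hCT.trans (le_sup_left.trans hg)
  exact hgy (LinearMap.mem_ker.mp (hker ▸ Submodule.mem_top))

lemma pow_smul_top_eq_smul_top
    (h : Submodule.torsionBySet R M I ⊔ I • (⊤ : Submodule R M) = ⊤) (n : ℕ) :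
    I ^ (n + 1) • (⊤ : Submodule R M) = I • ⊤ := by
  have hT : I • Submodule.torsionBySet R M I = ⊥ :=
    eq_bot_iff.mpr <| Submodule.smul_le.mpr fun a ha y hy ↦
      (Submodule.mem_bot R).mpr ((Submodule.mem_torsionBySet_iff _ _).mp hy ⟨a, ha⟩)
  have hsq : I • I • (⊤ : Submodule R M) = I • ⊤ := by
    conv_rhs => rw [← h, Submodule.smul_sup, hT, bot_sup_eq]
  induction n with
  | zero => simp
  | succ n ih => rw [pow_succ', Submodule.mul_smul, ih, hsq]

theorem IsSimpleDirectProjective.isSimpleDirectInjective [IsArtinianRing R]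
    (hM : IsSimpleDirectProjective R M) : IsSimpleDirectInjective R M := by
  rintro A B hA hB ⟨eA⟩ hBc
  obtain ⟨I, hI, ⟨e⟩⟩ := isSimpleModule_iff_quot_maximal.mp hB
  obtain ⟨n, hn, f, hff, hf⟩ := exists_pow_eq_span_isIdempotentElem I
  have hfI : f ∈ I := Ideal.pow_le_self hn (hf ▸ Ideal.mem_span_singleton_self f)
  have hAatom := isSimpleModule_iff_isAtom.mp hA
  obtain ⟨x, hxA, hx0⟩ := A.exists_mem_ne_zero_of_ne_bot hAatom.1
  have hfx : f • x = 0 := by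
    have : f • (⟨x, hxA⟩ : A) = 0 := by
      rw [← (eA.trans e).map_eq_zero_iff, map_smul, smul_quotient_eq_zero hfI]
    exact congrArg Subtype.val this
  have hx : x ∉ I • (⊤ : Submodule R M) := by
    intro hx
    obtain ⟨n, rfl⟩ := Nat.exists_eq_succ_of_ne_zero hn
    rw [← pow_smul_top_eq_smul_top (hM.torsionBySet_sup_smul_top hI hB e hBc) n,
      ← Nat.succ_eq_add_one, hf, Submodule.ideal_span_singleton_smul] at hx
    obtain ⟨y, -, rfl⟩ := Submodule.mem_smul_pointwise_iff_exists _ _ _ |>.mp hx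
    exact hx0 (by rwa [smul_smul, hff] at hfx)
  obtain ⟨g, -, hgx⟩ := exists_linearMap_quotient_ne_zero hI le_rfl hx
  have : IsSimpleModule R (R ⧸ I) := e.isSimpleModule_iff.mp hB
  have hg : g ≠ 0 := fun h ↦ hgx (by simp [h])
  exact ⟨_, isCompl_of_isAtom_of_isCoatom hAatom
    (LinearMap.isCoatom_ker_of_surjective (LinearMap.surjective_of_ne_zero hg))
    fun h ↦ hgx (h hxA)⟩

end Artinian

/-! ### Products of a simple module with a module without simple submodules or quotients -/

section Products

variable {R : Type*} [Ring R] {K X : Type*} [AddCommGroup K] [Module R K]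
  [AddCommGroup X] [Module R X]

lemma isComplemented_range_inl : IsComplemented (LinearMap.range (LinearMap.inl R K X)) :=
  ⟨_, LinearMap.isCompl_range_inl_inr⟩

variable [IsSimpleModule R K]

lemma isSimpleModule_range_inl : IsSimpleModule R (LinearMap.range (LinearMap.inl R K X)) :=
  (LinearEquiv.ofInjective _ LinearMap.inl_injective).isSimpleModule_iff.mp inferInstance

lemma eq_range_inl_of_le_ker_snd {A : Submodule R (K × X)} [IsSimpleModule R A]
    (h : A ≤ LinearMap.ker (LinearMap.snd R K X)) : A = LinearMap.range (LinearMap.inl R K X) := by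
  rw [← LinearMap.range_inl] at h
  exact ((isSimpleModule_iff_isAtom.mp isSimpleModule_range_inl).le_iff_eq
    (isSimpleModule_iff_isAtom.mp ‹_›).1).mp h

/-- If `X` has no simple submodule, then `K × 0` is the only simple submodule of `K × X`. -/
lemma isSimpleDirectInjective_prod
    (hX : ∀ (S : Submodule R (K × X)) [IsSimpleModule R S] (f : S →ₗ[R] X), f = 0) :
    IsSimpleDirectInjective R (K × X) := by
  rintro A - hA - - -
  rw [eq_range_inl_of_le_ker_snd (A := A) fun x hx ↦
    LinearMap.congr_fun (hX A ((LinearMap.snd R K X).comp A.subtype)) ⟨x, hx⟩]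
  exact isComplemented_range_inl

/-- A complement of the kernel of `K × X → X → K` would be a simple submodule, hence equal to
`K × 0`, which lies in that kernel. -/
lemma not_isSimpleDirectProjective_prod
    (hX : ∀ (S : Submodule R (K × X)) [IsSimpleModule R S] (f : S →ₗ[R] X), f = 0)
    {g : X →ₗ[R] K} (hg : g ≠ 0) : ¬ IsSimpleDirectProjective R (K × X) := by
  intro h
  have hsurj : Function.Surjective (g.comp (LinearMap.snd R K X)) :=
    (LinearMap.surjective_of_ne_zero hg).comp LinearMap.snd_surjective
  have e := (g.comp (LinearMap.snd R K X)).quotKerEquivOfSurjective hsurj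
  obtain ⟨C, hC⟩ := h _ (LinearMap.range (LinearMap.inl R K X)) isSimpleModule_range_inl
    ⟨e.trans (LinearEquiv.ofInjective _ LinearMap.inl_injective)⟩ isComplemented_range_inl
  have hCs : IsSimpleModule R C :=
    ((Submodule.quotientEquivOfIsCompl _ _ hC).symm.trans e).isSimpleModule_iff.mpr inferInstance
  have hle : C ≤ LinearMap.ker (g.comp (LinearMap.snd R K X)) := fun x hx ↦ by
    have hx0 : x.2 = 0 :=
      LinearMap.congr_fun (hX C ((LinearMap.snd R K X).comp C.subtype)) ⟨x, hx⟩
    simp [hx0]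
  exact (isSimpleModule_iff_isAtom.mp hCs).1 (hC.disjoint.symm.eq_bot_of_le hle)

/-- If `X` has no simple quotient, then `0 × X` is the only maximal submodule of `K × X`. -/
lemma isSimpleDirectProjective_prod
    (hX : ∀ (S : Submodule R (K × X)) [IsSimpleModule R S] (f : X →ₗ[R] S), f = 0) :
    IsSimpleDirectProjective R (K × X) := by
  rintro A B hB ⟨e⟩ -
  have hle : LinearMap.range (LinearMap.inr R K X) ≤ A := by
    rintro _ ⟨x, rfl⟩
    have : e (A.mkQ (LinearMap.inr R K X x)) = 0 := LinearMap.congr_fun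
      (hX B (e.toLinearMap.comp (A.mkQ.comp (LinearMap.inr R K X)))) x
    simpa using this
  have hco : IsCoatom (LinearMap.range (LinearMap.inr R K X)) := by
    rw [LinearMap.range_inr]
    exact LinearMap.isCoatom_ker_of_surjective LinearMap.fst_surjective
  have hA := isSimpleModule_iff_isCoatom.mp (e.isSimpleModule_iff.mpr hB)
  rw [(hco.le_iff_eq hA.1).mp hle]
  exact ⟨_, LinearMap.isCompl_range_inl_inr.symm⟩

/-- A projection of `K × X` onto a copy of `K` inside `0 × X` would give a nonzero map from `X`
to a simple module. -/
lemma not_isSimpleDirectInjective_prod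
    (hX : ∀ (S : Submodule R (K × X)) [IsSimpleModule R S] (f : X →ₗ[R] S), f = 0)
    {g : K →ₗ[R] X} (hg : g ≠ 0) : ¬ IsSimpleDirectInjective R (K × X) := by
  intro h
  have hinj : Function.Injective ((LinearMap.inr R K X).comp g) :=
    LinearMap.inr_injective.comp (LinearMap.injective_of_ne_zero hg)
  have e := LinearEquiv.ofInjective _ hinj
  have hS : IsSimpleModule R (LinearMap.range ((LinearMap.inr R K X).comp g)) :=
    e.isSimpleModule_iff.mp inferInstance
  obtain ⟨C, hC⟩ := h _ (LinearMap.range (LinearMap.inl R K X)) hS isSimpleModule_range_inl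
    ⟨e.symm.trans (LinearEquiv.ofInjective _ LinearMap.inl_injective)⟩ isComplemented_range_inl
  refine hg (LinearMap.ext fun x ↦ ?_)
  have hmem : (LinearMap.inr R K X) (g x) ∈ LinearMap.range ((LinearMap.inr R K X).comp g) :=
    ⟨x, rfl⟩
  have h0 := LinearMap.congr_fun
    (hX _ ((Submodule.projectionOnto _ C hC).comp (LinearMap.inr R K X))) (g x)
  rw [LinearMap.comp_apply, Submodule.projectionOnto_apply_of_mem_left hC hmem] at h0
  exact LinearMap.inr_injective ((congrArg Subtype.val h0).trans (map_zero _).symm)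

/-- `ULift` moves the product to the universe in which the modules `M` live. -/
lemma exists_isSimpleDirectInjective_not_isSimpleDirectProjective {R : Type u} [Ring R]
    {K X : Type u} [AddCommGroup K] [Module R K] [IsSimpleModule R K] [AddCommGroup X] [Module R X]
    (hX : ∀ (S : Type (max u v)) [AddCommGroup S] [Module R S] [IsSimpleModule R S]
      (f : S →ₗ[R] X), f = 0) {g : X →ₗ[R] K} (hg : g ≠ 0) :
    ∃ (M : Type (max u v)) (_ : AddCommGroup M) (_ : Module R M),
      IsSimpleDirectInjective R M ∧ ¬ IsSimpleDirectProjective R M := by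
  let eK : ULift.{v} K ≃ₗ[R] K := ULift.moduleEquiv
  let eX : ULift.{v} X ≃ₗ[R] X := ULift.moduleEquiv
  have : IsSimpleModule R (ULift.{v} K) := eK.isSimpleModule_iff.mpr inferInstance
  have hX' : ∀ (S : Submodule R (ULift.{v} K × ULift.{v} X)) [IsSimpleModule R S]
      (f : S →ₗ[R] ULift.{v} X), f = 0 := fun S _ f ↦ LinearMap.ext fun s ↦
    eX.injective <| LinearMap.congr_fun (hX S (eX.toLinearMap.comp f)) s
  have hg' : eK.symm.toLinearMap.comp (g.comp eX.toLinearMap) ≠ 0 := fun h0 ↦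
    hg <| LinearMap.ext fun x ↦ by simpa using LinearMap.congr_fun h0 (eX.symm x)
  exact ⟨_, _, _, isSimpleDirectInjective_prod hX', not_isSimpleDirectProjective_prod hX' hg'⟩

lemma exists_isSimpleDirectProjective_not_isSimpleDirectInjective {R : Type u} [Ring R]
    {K X : Type u} [AddCommGroup K] [Module R K] [IsSimpleModule R K] [AddCommGroup X] [Module R X]
    (hX : ∀ (S : Type (max u v)) [AddCommGroup S] [Module R S] [IsSimpleModule R S]
      (f : X →ₗ[R] S), f = 0) {g : K →ₗ[R] X} (hg : g ≠ 0) :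
    ∃ (M : Type (max u v)) (_ : AddCommGroup M) (_ : Module R M),
      IsSimpleDirectProjective R M ∧ ¬ IsSimpleDirectInjective R M := by
  let eK : ULift.{v} K ≃ₗ[R] K := ULift.moduleEquiv
  let eX : ULift.{v} X ≃ₗ[R] X := ULift.moduleEquiv
  have : IsSimpleModule R (ULift.{v} K) := eK.isSimpleModule_iff.mpr inferInstance
  have hX' : ∀ (S : Submodule R (ULift.{v} K × ULift.{v} X)) [IsSimpleModule R S]
      (f : ULift.{v} X →ₗ[R] S), f = 0 := fun S _ f ↦ LinearMap.ext fun x ↦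
    LinearMap.congr_fun (hX S (f.comp eX.symm.toLinearMap)) (eX x)
  have hg' : eX.symm.toLinearMap.comp (g.comp eK.toLinearMap) ≠ 0 := fun h0 ↦
    hg <| LinearMap.ext fun x ↦ by simpa using LinearMap.congr_fun h0 (eK.symm x)
  exact ⟨_, _, _, isSimpleDirectProjective_prod hX', not_isSimpleDirectInjective_prod hX' hg'⟩

end Products

/-! ### Non-maximal primes -/

section NonMaximalPrime

variable {R : Type*} [CommRing R] {p m : Ideal R} [p.IsPrime]

/-- A nonzero element of `R ⧸ p` has annihilator `p`, which is not a maximal ideal. -/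
lemma linearMap_simple_to_quotient_prime_eq_zero (hp : ¬ p.IsMaximal) {S : Type*} [AddCommGroup S]
    [Module R S] [IsSimpleModule R S] (f : S →ₗ[R] R ⧸ p) : f = 0 := by
  by_contra hf
  obtain ⟨s, hs⟩ : ∃ s, f s ≠ 0 := by
    by_contra! h
    exact hf (LinearMap.ext h)
  have hmax := IsSimpleModule.annihilator_isMaximal (R := R) (M := S)
  have hle : Module.annihilator R S ≤ p := fun a ha ↦ by
    have : a • f s = 0 := by rw [← map_smul, Module.mem_annihilator.mp ha, map_zero]
    rw [Algebra.smul_def, Ideal.Quotient.algebraMap_eq] at this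
    exact Ideal.Quotient.eq_zero_iff_mem.mp ((mul_eq_zero.mp this).resolve_right hs)
  exact hp (hmax.eq_of_le (Ideal.IsPrime.ne_top ‹_›) hle ▸ hmax)

/-- The annihilator of a simple module is maximal, so it contains an element outside `p`, and that
element acts invertibly on `κ(p)`. -/
lemma linearMap_residueField_to_simple_eq_zero (hp : ¬ p.IsMaximal) {S : Type*} [AddCommGroup S]
    [Module R S] [IsSimpleModule R S] (f : p.ResidueField →ₗ[R] S) : f = 0 := by
  have hmax := IsSimpleModule.annihilator_isMaximal (R := R) (M := S)
  obtain ⟨a, ha, hap⟩ : ∃ a ∈ Module.annihilator R S, a ∉ p := by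
    by_contra! hle
    exact hp (hmax.eq_of_le (Ideal.IsPrime.ne_top ‹_›) hle ▸ hmax)
  ext y
  have ha0 : algebraMap R p.ResidueField a ≠ 0 := by
    rwa [Ne, Ideal.algebraMap_residueField_eq_zero]
  have hy : y = a • ((algebraMap R p.ResidueField a)⁻¹ * y) := by
    rw [Algebra.smul_def, mul_inv_cancel_left₀ ha0]
  rw [hy, map_smul, Module.mem_annihilator.mp ha, LinearMap.zero_apply]

lemma mapQ_algebraMap_residueField_ne_zero (hpm : p ≤ m) (hm : m ≠ ⊤) :
    m.mapQ (Submodule.map (Algebra.linearMap R p.ResidueField) m)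
      (Algebra.linearMap R p.ResidueField)
      (Submodule.le_comap_map _ _) ≠ 0 := by
  intro h
  have h1 := LinearMap.congr_fun h (Submodule.Quotient.mk 1)
  rw [Submodule.mapQ_apply, LinearMap.zero_apply, Submodule.Quotient.mk_eq_zero] at h1
  obtain ⟨a, ha, h1⟩ := h1
  have hsub : a - 1 ∈ p := by
    rw [← Ideal.algebraMap_residueField_eq_zero (I := p), map_sub, sub_eq_zero]
    exact h1
  exact hm ((Ideal.eq_top_iff_one m).mpr (by simpa using m.sub_mem ha (hpm hsub)))

end NonMaximalPrime

/-! ### The equivalence -/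

lemma exists_prime_lt_maximal_of_not_isArtinianRing (R : Type*) [CommRing R] [IsNoetherianRing R]
    (h : ¬ IsArtinianRing R) :
    ∃ p m : Ideal R, p.IsPrime ∧ ¬ p.IsMaximal ∧ m.IsMaximal ∧ p ≤ m := by
  rw [isArtinianRing_iff_krullDimLE_zero, Ring.krullDimLE_zero_iff] at h
  push Not at h
  obtain ⟨p, hp, hpm⟩ := h
  obtain ⟨m, hm, hle⟩ := p.exists_le_maximal hp.ne_top
  exact ⟨p, m, hp, hpm, hm, hle⟩

theorem corollary4p11 (R : Type u) [CommRing R] [IsNoetherianRing R] :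
    List.TFAE [
      IsArtinianRing R,
      ∀ (M : Type (max u v)) [AddCommGroup M] [Module R M],
        IsSimpleDirectInjective R M → IsSimpleDirectProjective R M,
      ∀ (M : Type (max u v)) [AddCommGroup M] [Module R M],
        IsSimpleDirectProjective R M → IsSimpleDirectInjective R M] := by
  tfae_have 1 → 2 := fun _ M _ _ h ↦ h.isSimpleDirectProjective
  tfae_have 1 → 3 := fun _ M _ _ h ↦ h.isSimpleDirectInjective
  tfae_have 2 → 1 := by
    intro h
    by_contra hR
    obtain ⟨p, m, hp, hpm, hm, hle⟩ := exists_prime_lt_maximal_of_not_isArtinianRing R hR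
    have : IsSimpleModule R (R ⧸ m) := isSimpleModule_iff_isCoatom.mpr (Ideal.isMaximal_def.mp hm)
    have hg : (Submodule.factor hle : (R ⧸ p) →ₗ[R] R ⧸ m) ≠ 0 := fun h0 ↦
      hm.ne_top <| (Ideal.eq_top_iff_one m).mpr <| (Submodule.Quotient.mk_eq_zero m).mp <|
        LinearMap.congr_fun h0 (Submodule.Quotient.mk 1)
    obtain ⟨M, _, _, hi, hnp⟩ := exists_isSimpleDirectInjective_not_isSimpleDirectProjective.{u, v}
      (fun S _ _ _ f ↦ linearMap_simple_to_quotient_prime_eq_zero hpm f) hg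
    exact hnp (h M hi)
  tfae_have 3 → 1 := by
    intro h
    by_contra hR
    obtain ⟨p, m, hp, hpm, hm, hle⟩ := exists_prime_lt_maximal_of_not_isArtinianRing R hR
    have : IsSimpleModule R (R ⧸ m) := isSimpleModule_iff_isCoatom.mpr (Ideal.isMaximal_def.mp hm)
    obtain ⟨M, _, _, hp, hni⟩ := exists_isSimpleDirectProjective_not_isSimpleDirectInjective.{u, v}
      (fun S _ _ _ f ↦ (Submodule.linearMap_qext _ <|
        linearMap_residueField_to_simple_eq_zero hpm (f.comp (Submodule.mkQ _)) : f = 0))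
      (mapQ_algebraMap_residueField_ne_zero hle hm.ne_top)
    exact hni (h M hp)
  tfae_finish
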